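/- Let $(X,d)$ be a compact metric space. Let $\mathcal{M}(X)$ be the space of all finite signed Borel measures on $X$ and $\mathcal{M}_0(X)$ its subspace of measures of total mass $0$. For $\mu,\nu\in\mathcal{M}(X)$ put $$I(\mu,\nu)=\int_X\int_X d(x,y)\,d\mu(x)\,d\nu(y),\qquad M(X)=\sup\{I(\mu,\mu):\mu\in\mathcal{M}(X),\ \mu(X)=1\}.$$ Assume that $X$ is quasihypermetric, that is, $\sum_{i,j=1}^n\alpha_i\alpha_j d(x_i,x_j)\le 0$ for all $n\in\mathbb{N}$, all $x_1,\dots,x_n\in X$ and all $\alpha_1,\dots,\alpha_n\in\mathbb{R}$ with $\sum_{i=1}^n\alpha_i=0$, so that $(\mu\mid\nu)=-I(\mu,\nu)$ is a semi-inner product on $\mathcal{M}_0(X)$; let $E_0(X)$ denote $\mathcal{M}_0(X)$ with this semi-inner product and the associated seminorm $\|\mu\|=(-I(\mu,\mu))^{1/2}$. If $M(X)<\infty$, then the semi-inner product space $E_0(X)$ is complete if and only if $X$ is finite. -/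

import Mathlib

open MeasureTheory

noncomputable section

namespace DistGeom

/-- A metric space is quasihypermetric if `∑ i j, α i * α j * d (x i) (x j) ≤ 0` for all finite
families of points `x i` and of real weights `α i` with `∑ i, α i = 0`. -/
def IsQuasihypermetric (X : Type*) [MetricSpace X] : Prop :=
  ∀ (n : ℕ) (α : Fin n → ℝ) (x : Fin n → X), ∑ i, α i = 0 →
    ∑ i, ∑ j, α i * α j * dist (x i) (x j) ≤ 0

section Energy

variable {X : Type*} [MetricSpace X] [MeasurableSpace X]

/-- `I(μ, ν) = ∫∫ d(x, y) dμ(x) dν(y)`. -/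
def energy (μ ν : SignedMeasure X) : ℝ :=
  ∫ᵛ y, (∫ᵛ x, dist x y ∂•μ) ∂•ν

variable (X) in
/-- `M(X) = sup {I(μ, μ) : μ a finite signed Borel measure of total mass 1}`, as an extended real
number. -/
def maxEnergy : EReal :=
  ⨆ (μ : SignedMeasure X) (_ : μ Set.univ = 1), ((energy μ μ : ℝ) : EReal)

variable (X) in
/-- The space `M₀(X)` of finite signed Borel measures of total mass `0`. -/
def massZero : Submodule ℝ (SignedMeasure X) where
  carrier := {μ | μ Set.univ = 0}
  zero_mem' := by simp
  add_mem' := by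
    intro μ ν hμ hν
    simp only [Set.mem_ofPred_eq] at *
    simp [hμ, hν]
  smul_mem' := by
    intro c μ hμ
    simp only [Set.mem_ofPred_eq] at *
    simp [hμ]

end Energy

section Facts

variable {X : Type*} [MetricSpace X] [MeasurableSpace X]

lemma isFiniteMeasure_variation (μ : SignedMeasure X) : IsFiniteMeasure μ.variation := by
  rw [← SignedMeasure.totalVariation_eq_variation]
  infer_instance

variable [CompactSpace X] [BorelSpace X]

lemma integrable_of_continuous (μ : SignedMeasure X) {f : X → ℝ} (hf : Continuous f) :
    μ.Integrable f := by
  have := isFiniteMeasure_variation μ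
  obtain ⟨C, hC⟩ := isCompact_univ.exists_bound_of_continuousOn hf.continuousOn
  exact Integrable.of_bound hf.aestronglyMeasurable C
    (Filter.Eventually.of_forall fun x => hC x (Set.mem_univ x))

lemma dist_le_diam (x y : X) : dist x y ≤ Metric.diam (Set.univ : Set X) :=
  Metric.dist_le_diam_of_mem isCompact_univ.isBounded (Set.mem_univ x) (Set.mem_univ y)

lemma continuous_inner (μ : SignedMeasure X) : Continuous fun y => ∫ᵛ x, dist x y ∂•μ := by
  have := isFiniteMeasure_variation μ
  refine VectorMeasure.continuous_of_dominated
    (bound := fun _ => Metric.diam (Set.univ : Set X)) ?_ ?_ ?_ ?_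
  · intro y
    exact (by fun_prop : Continuous fun x : X => dist x y).aestronglyMeasurable
  · intro y
    refine Filter.Eventually.of_forall fun x => ?_
    rw [Real.norm_of_nonneg dist_nonneg]
    exact dist_le_diam x y
  · exact integrable_const _
  · refine Filter.Eventually.of_forall fun x => ?_
    fun_prop

lemma energy_add_left (μ₁ μ₂ ν : SignedMeasure X) :
    energy (μ₁ + μ₂) ν = energy μ₁ ν + energy μ₂ ν := by
  unfold energy
  rw [← VectorMeasure.integral_fun_add (integrable_of_continuous ν (continuous_inner μ₁))
    (integrable_of_continuous ν (continuous_inner μ₂))]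
  congr 1
  ext y
  exact VectorMeasure.integral_add_vectorMeasure
    (integrable_of_continuous μ₁ (by fun_prop)) (integrable_of_continuous μ₂ (by fun_prop))

lemma energy_smul_left (c : ℝ) (μ ν : SignedMeasure X) :
    energy (c • μ) ν = c * energy μ ν := by
  unfold energy
  rw [← smul_eq_mul, ← VectorMeasure.integral_fun_smul]
  congr 1
  ext y
  exact VectorMeasure.integral_smul_vectorMeasure _ _

/-- Integral of a function of a simple function. -/
lemma integral_comp_simpleFunc (μ : SignedMeasure X) (s : SimpleFunc X X) (f : X → ℝ) :
    ∫ᵛ x, f (s x) ∂•μ = ∑ a ∈ s.range, f a * μ (s ⁻¹' {a}) := by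
  classical
  have := isFiniteMeasure_variation μ
  have h : ∀ x, f (s x) = ∑ a ∈ s.range, (s ⁻¹' {a}).indicator (fun _ => f a) x := by
    intro x
    rw [Finset.sum_eq_single (s x)]
    · simp
    · intro b _ hb
      simp [Set.indicator, Ne.symm hb]
    · intro hx
      exact absurd (s.mem_range_self x) hx
  simp_rw [h]
  rw [VectorMeasure.integral_finsetSum]
  · refine Finset.sum_congr rfl fun a _ => ?_
    rw [VectorMeasure.integral_indicator_const]
    · simp
    · exact s.measurableSet_preimage _
  · intro a _
    exact (integrable_const _).indicator (s.measurableSet_preimage _)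

/-- The energy is a limit of discrete energies. -/
lemma exists_tendsto_energy : ∃ s : ℕ → SimpleFunc X X, ∀ μ ν : SignedMeasure X,
    Filter.Tendsto (fun n => ∑ b ∈ (s n).range, ∑ a ∈ (s n).range,
      μ (s n ⁻¹' {a}) * ν (s n ⁻¹' {b}) * dist a b) Filter.atTop (nhds (energy μ ν)) := by
  rcases isEmpty_or_nonempty X with hX | ⟨⟨x₀⟩⟩
  · refine ⟨fun _ => ⟨id, fun x => isEmptyElim x, Set.toFinite _⟩, fun μ ν => ?_⟩
    have h1 : μ = 0 := by
      ext i _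
      simp [Set.eq_empty_of_isEmpty i]
    have h2 : energy μ ν = 0 := by
      subst h1
      simp [energy]
    rw [h2, h1]
    simp
  let s : ℕ → SimpleFunc X X :=
    fun n => SimpleFunc.approxOn (fun x : X => x) measurable_id Set.univ x₀ (Set.mem_univ _) n
  have hs : ∀ x, Filter.Tendsto (fun n => s n x) Filter.atTop (nhds x) := fun x =>
    SimpleFunc.tendsto_approxOn measurable_id (Set.mem_univ _) (by simp)
  refine ⟨s, fun μ ν => ?_⟩
  have := isFiniteMeasure_variation μ
  have := isFiniteMeasure_variation ν
  have key : ∀ n, ∑ b ∈ (s n).range, ∑ a ∈ (s n).range,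
      μ (s n ⁻¹' {a}) * ν (s n ⁻¹' {b}) * dist a b
      = ∫ᵛ y, (∫ᵛ x, dist (s n x) (s n y) ∂•μ) ∂•ν := by
    intro n
    rw [integral_comp_simpleFunc ν (s n) (fun b => ∫ᵛ x, dist (s n x) b ∂•μ)]
    refine Finset.sum_congr rfl fun b _ => ?_
    rw [integral_comp_simpleFunc μ (s n) (fun a => dist a b), Finset.sum_mul]
    refine Finset.sum_congr rfl fun a _ => ?_
    ring
  simp_rw [key]
  unfold energy
  refine VectorMeasure.tendsto_integral_filter_of_dominated_convergence
    (bound := fun _ => Metric.diam (Set.univ : Set X) *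
      ‖ContinuousLinearMap.lsmul ℝ ℝ (E := ℝ)‖ * μ.variation.real Set.univ) ?_ ?_ ?_ ?_
  · refine Filter.Eventually.of_forall fun n => ?_
    exact (((s n).map fun b => ∫ᵛ x, dist (s n x) b ∂•μ).stronglyMeasurable).aestronglyMeasurable
  · refine Filter.Eventually.of_forall fun n => Filter.Eventually.of_forall fun y => ?_
    refine VectorMeasure.norm_integral_le_of_norm_le_const (Filter.Eventually.of_forall fun x => ?_)
    rw [Real.norm_of_nonneg dist_nonneg]
    exact dist_le_diam _ _
  · exact integrable_const _
  · refine Filter.Eventually.of_forall fun y => ?_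
    refine VectorMeasure.tendsto_integral_filter_of_dominated_convergence
      (bound := fun _ => Metric.diam (Set.univ : Set X)) ?_ ?_ ?_ ?_
    · refine Filter.Eventually.of_forall fun n => ?_
      exact ((s n).map fun a => dist a (s n y)).stronglyMeasurable.aestronglyMeasurable
    · refine Filter.Eventually.of_forall fun n => Filter.Eventually.of_forall fun x => ?_
      rw [Real.norm_of_nonneg dist_nonneg]
      exact dist_le_diam _ _
    · exact integrable_const _
    · exact Filter.Eventually.of_forall fun x => (hs x).dist (hs y)

lemma energy_comm (μ ν : SignedMeasure X) : energy μ ν = energy ν μ := by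
  obtain ⟨s, hs⟩ := exists_tendsto_energy (X := X)
  refine tendsto_nhds_unique (hs μ ν) ((hs ν μ).congr fun n => ?_)
  rw [Finset.sum_comm]
  refine Finset.sum_congr rfl fun a _ => Finset.sum_congr rfl fun b _ => ?_
  rw [dist_comm]
  ring

lemma energy_self_nonpos (hX : IsQuasihypermetric X) (μ : SignedMeasure X)
    (hμ : μ Set.univ = 0) : energy μ μ ≤ 0 := by
  obtain ⟨s, hs⟩ := exists_tendsto_energy (X := X)
  refine le_of_tendsto' (hs μ μ) fun n => ?_
  have hsum : ∑ a ∈ (s n).range, μ (s n ⁻¹' {a}) = 0 := by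
    have h := integral_comp_simpleFunc μ (s n) (fun _ => 1)
    have := isFiniteMeasure_variation μ
    simp only [one_mul] at h
    rw [← h, VectorMeasure.integral_const]
    simp [hμ]
  let e := (s n).range.equivFin
  have h := hX _ (fun i => μ (s n ⁻¹' {(e.symm i : X)})) (fun i => (e.symm i : X)) (by
    rw [e.symm.sum_comp (fun a : (s n).range => μ (s n ⁻¹' {(a : X)})),
      Finset.sum_coe_sort (s n).range (fun a => μ (s n ⁻¹' {a}))]
    exact hsum)
  refine le_of_eq_of_le ?_ h
  rw [e.symm.sum_comp (fun b : (s n).range => ∑ j, μ (s n ⁻¹' {(b : X)}) *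
    μ (s n ⁻¹' {(e.symm j : X)}) * dist (b : X) (e.symm j : X)),
    Finset.sum_coe_sort (s n).range (fun b => ∑ j, μ (s n ⁻¹' {b}) *
    μ (s n ⁻¹' {(e.symm j : X)}) * dist b (e.symm j : X))]
  refine Finset.sum_congr rfl fun b _ => ?_
  rw [e.symm.sum_comp (fun a : (s n).range => μ (s n ⁻¹' {b}) *
    μ (s n ⁻¹' {(a : X)}) * dist b (a : X)),
    Finset.sum_coe_sort (s n).range (fun a => μ (s n ⁻¹' {b}) *
    μ (s n ⁻¹' {a}) * dist b a)]
  refine Finset.sum_congr rfl fun a _ => ?_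
  rw [dist_comm]
  ring

end Facts

section SemiInner

/-- The underlying vector space of `E₀(X)` is the space of finite signed Borel measures of total
mass `0`. -/
def E₀ (X : Type*) [MetricSpace X] [MeasurableSpace X] (_hX : IsQuasihypermetric X) : Type _ :=
  massZero X

variable {X : Type*} [MetricSpace X] [MeasurableSpace X] (hX : IsQuasihypermetric X)

/-- The signed measure underlying an element of `E₀(X)`. -/
def E₀.toMeasure {hX : IsQuasihypermetric X} (μ : E₀ X hX) : SignedMeasure X :=
  Subtype.val (p := fun ν => ν ∈ massZero X) μ

instance E₀.instAddCommGroup : AddCommGroup (E₀ X hX) :=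
  inferInstanceAs (AddCommGroup (massZero X))

instance E₀.instModule : Module ℝ (E₀ X hX) :=
  inferInstanceAs (Module ℝ (massZero X))

variable [CompactSpace X] [BorelSpace X]

/-- The semi-inner product `(μ | ν) = -I(μ, ν)` on the measures of total mass `0`. -/
@[reducible]
def E₀.core : PreInnerProductSpace.Core ℝ (E₀ X hX) where
  inner μ ν := -energy μ.toMeasure ν.toMeasure
  conj_inner_symm μ ν := by
    rw [energy_comm ν.toMeasure μ.toMeasure]
    rfl
  re_inner_nonneg μ := by
    have h := energy_self_nonpos hX μ.toMeasure μ.2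
    simpa using h
  add_left μ₁ μ₂ ν := by
    have h := energy_add_left μ₁.toMeasure μ₂.toMeasure ν.toMeasure
    change -energy (μ₁.toMeasure + μ₂.toMeasure) ν.toMeasure = _
    rw [h]
    ring
  smul_left μ ν c := by
    have h := energy_smul_left c μ.toMeasure ν.toMeasure
    change -energy (c • μ.toMeasure) ν.toMeasure = _
    rw [h]
    simp

/-- The seminorm `‖μ‖ = (-I(μ, μ)) ^ (1/2)` on `E₀(X)`, with its topology and uniformity. -/
instance E₀.instSeminormedAddCommGroup : SeminormedAddCommGroup (E₀ X hX) :=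
  @InnerProductSpace.Core.toSeminormedAddCommGroup ℝ (E₀ X hX) _ _ _ (E₀.core hX)

instance E₀.instInnerProductSpace : InnerProductSpace ℝ (E₀ X hX) :=
  InnerProductSpace.ofCore (E₀.core hX)

lemma E₀.inner_eq (μ ν : E₀ X hX) : inner ℝ μ ν = -energy μ.toMeasure ν.toMeasure := rfl

lemma E₀.norm_eq (μ : E₀ X hX) : ‖μ‖ = Real.sqrt (-energy μ.toMeasure μ.toMeasure) := rfl

end SemiInner

end DistGeom

end

noncomputable section

namespace DistGeom

lemma finiteDimensional_signedMeasure (Y : Type*) [MeasurableSpace Y] [Finite Y] :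
    FiniteDimensional ℝ (SignedMeasure Y) :=
  Module.Finite.of_injective
    ({ toFun := fun μ s => μ s
       map_add' := fun _ _ => rfl
       map_smul' := fun _ _ => rfl } : SignedMeasure Y →ₗ[ℝ] Set Y → ℝ)
    fun _ _ h => VectorMeasure.ext fun s _ => congrFun h s

/-- A finite-dimensional real seminormed space is complete. -/
lemma completeSpace_of_finiteDimensional (E : Type*) [SeminormedAddCommGroup E] [NormedSpace ℝ E]
    [FiniteDimensional ℝ E] : CompleteSpace E :=
  SeparationQuotient.completeSpace_iff.1 (FiniteDimensional.complete ℝ (SeparationQuotient E))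

lemma finite_of_forall_le_dist {Y : Type*} [MetricSpace Y] [CompactSpace Y] {r : ℝ} (hr : 0 < r)
    (h : ∀ x y : Y, x ≠ y → r ≤ dist x y) : Finite Y := by
  have : DiscreteTopology Y := discreteTopology_iff_isOpen_singleton.2 fun x => by
    have hx : Metric.ball x r = {x} := by
      ext y
      refine ⟨fun hy => ?_, fun hy => ?_⟩
      · by_contra hne
        exact absurd (Metric.mem_ball.1 hy) (not_lt.2 (h y x hne))
      · rw [Set.mem_singleton_iff.1 hy]
        exact Metric.mem_ball_self hr
    exact hx ▸ Metric.isOpen_ball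
  exact finite_of_compact_of_discrete

variable {X : Type*} [MetricSpace X] [MeasurableSpace X] [CompactSpace X] [BorelSpace X]
  (hX : IsQuasihypermetric X)

/-- The element `δ_x - δ_y` of `E₀(X)`. -/
def E₀.diracSub (x y : X) : E₀ X hX :=
  (⟨VectorMeasure.dirac x 1 - VectorMeasure.dirac y 1, by
    change _ = _
    simp⟩ : massZero X)

lemma integral_diracSub {f : X → ℝ} (hf : Continuous f) (x y : X) :
    ∫ᵛ z, f z ∂•(E₀.diracSub hX x y).toMeasure = f x - f y := by
  change ∫ᵛ z, f z ∂•(VectorMeasure.dirac x 1 - VectorMeasure.dirac y 1 : SignedMeasure X) = _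
  rw [VectorMeasure.integral_sub_vectorMeasure (integrable_of_continuous _ hf)
    (integrable_of_continuous _ hf), VectorMeasure.integral_dirac, VectorMeasure.integral_dirac]
  simp

lemma inner_diracSub (x y : X) (μ : E₀ X hX) :
    inner ℝ (E₀.diracSub hX x y) μ = -∫ᵛ z, (dist x z - dist y z) ∂•μ.toMeasure := by
  rw [E₀.inner_eq, energy]
  congr 2
  ext z
  exact integral_diracSub hX (f := fun w => dist w z) (by fun_prop) x y

lemma norm_diracSub_sq (x y : X) : ‖E₀.diracSub hX x y‖ ^ 2 = 2 * dist x y := by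
  rw [← real_inner_self_eq_norm_sq, inner_diracSub,
    integral_diracSub hX (f := fun z => dist x z - dist y z) (by fun_prop)]
  simp only [dist_self, dist_comm y x]
  ring

/-- For fixed `μ`, the pairing with `δ_x - δ_y` is Lipschitz in `d(x, y)`, with a constant
controlled by the total variation of `μ`. -/
lemma exists_abs_inner_diracSub_le (μ : E₀ X hX) :
    ∃ C, ∀ x y : X, |inner ℝ (E₀.diracSub hX x y) μ| ≤ C * dist x y := by
  have := isFiniteMeasure_variation μ.toMeasure
  refine ⟨‖ContinuousLinearMap.lsmul ℝ ℝ (E := ℝ)‖ * μ.toMeasure.variation.real Set.univ,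
    fun x y => ?_⟩
  rw [inner_diracSub, abs_neg, mul_comm, ← mul_assoc, ← Real.norm_eq_abs]
  refine VectorMeasure.norm_integral_le_of_norm_le_const (Filter.Eventually.of_forall fun z => ?_)
  exact abs_dist_sub_le x y z

/-- If `E₀(X)` is complete then, by the uniform boundedness principle applied to the functionals
`(δ_x - δ_y | ·) / d(x, y)`, distinct points of `X` stay a fixed distance apart. -/
lemma exists_pos_le_dist_of_completeSpace [CompleteSpace (E₀ X hX)] :
    ∃ r : ℝ, 0 < r ∧ ∀ x y : X, x ≠ y → r ≤ dist x y := by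
  obtain ⟨C, hC⟩ := banach_steinhaus
    (g := fun p : X × X => innerSL ℝ ((dist p.1 p.2)⁻¹ • E₀.diracSub hX p.1 p.2)) fun μ => by
      obtain ⟨C, hC⟩ := exists_abs_inner_diracSub_le hX μ
      refine ⟨|C|, fun p => ?_⟩
      rw [innerSL_apply_apply, real_inner_smul_left, norm_mul, norm_inv, Real.norm_eq_abs,
        Real.norm_eq_abs, abs_of_nonneg dist_nonneg]
      rcases (dist_nonneg (x := p.1) (y := p.2)).eq_or_lt with h | h
      · simp [← h]
      · rw [inv_mul_le_iff₀ h, mul_comm]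
        exact (hC _ _).trans (mul_le_mul_of_nonneg_right (le_abs_self C) h.le)
  refine ⟨2 / (C ^ 2 + 1), by positivity, fun x y hxy => ?_⟩
  have hd : 0 < dist x y := dist_pos.2 hxy
  have h := hC (x, y)
  rw [innerSL_apply_norm, norm_smul, norm_inv, Real.norm_of_nonneg hd.le, inv_mul_le_iff₀ hd] at h
  have hsq := pow_le_pow_left₀ (norm_nonneg _) h 2
  rw [norm_diracSub_sq, mul_pow, sq (dist x y), mul_assoc, mul_comm, mul_le_mul_iff_right₀ hd]
    at hsq
  rw [div_le_iff₀ (by positivity)]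
  linarith

end DistGeom

end

/-- For a compact quasihypermetric space `X` with `M(X) < ∞`, the semi-inner product space `E₀(X)`
is complete if and only if `X` is finite. -/
theorem theorem2p31 {X : Type*} [MetricSpace X] [CompactSpace X] [MeasurableSpace X] [BorelSpace X]
    (hX : DistGeom.IsQuasihypermetric X) (hM : DistGeom.maxEnergy X < ⊤) :
    CompleteSpace (DistGeom.E₀ X hX) ↔ Finite X := by
  constructor
  · intro _
    obtain ⟨r, hr, h⟩ := DistGeom.exists_pos_le_dist_of_completeSpace hX
    exact DistGeom.finite_of_forall_le_dist hr h
  · intro _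
    have := DistGeom.finiteDimensional_signedMeasure X
    have : FiniteDimensional ℝ (DistGeom.E₀ X hX) :=
      inferInstanceAs (FiniteDimensional ℝ (DistGeom.massZero X))
    exact DistGeom.completeSpace_of_finiteDimensional _
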